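/- Let $k$ be a finite field and let $\mathcal D$ be a $k$-linear triangulated category (with shift $[1]$) which is Krull--Schmidt and left homologically finite, i.e. $\sum_{i\ge 0}\dim_k\operatorname{Hom}_{\mathcal D}(X[i],Y)<\infty$ for all objects $X,Y$. Write $K_0(\mathcal D)$ for its Grothendieck group and $\underline{\dim}M$ for the class of $M$. For objects $L,M,N$ put $$F_{MN}^L=\frac{|(L,N)_{M[1]}|}{|\operatorname{Aut}N|}\,\frac{\{L,N\}}{\{N,N\}},\qquad (L,N)_{M[1]}=\{f\in\operatorname{Hom}(L,N):\operatorname{cone}f\cong M[1]\},\qquad \{L,N\}=\prod_{i>0}|\operatorname{Hom}(L[i],N)|^{(-1)^i}.$$ For $\mathbb Q$-valued functions $f,g$ on isomorphism classes of objects, the derived Hall product is $(f*g)(L)=\sum_{[M],[N]}F_{MN}^L\,f(M)\,g(N)$, defined whenever for each $L$ only finitely many terms are nonzero; iterated products are formed from left to right. Let $\sigma=(Z,\mathcal P)$ be a stability condition on $\mathcal D$ in the sense of Bridgeland: $Z:K_0(\mathcal D)\to\mathbb C$ is a group homomorphism and $\mathcal P(\phi)$, $\phi\in\mathbb R$, are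 full additive extension-closed subcategories such that (1) $Z(\underline{\dim}M)\in\mathbb R_{>0}e^{i\pi\phi}$ for $0\ne M\in\mathcal P(\phi)$; (2) $\mathcal P(\phi+1)=\mathcal P(\phi)[1]$; (3) $\operatorname{Hom}(A_1,A_2)=0$ for $A_i\in\mathcal P(\phi_i)$, $\phi_1>\phi_2$; (4) every $M\neq0$ has a Harder--Narasimhan filtration, i.e. triangles $M_{i-1}\to M_i\to A_i\to M_{i-1}[1]$, $1\le i\le n$, with $M_0=0$, $M_n=M$, $0\ne A_i\in\mathcal P(\phi_i)$ and $\phi_1>\dots>\phi_n$. This filtration is unique up to isomorphism; put $\phi^-(M)=\phi_n$. For $\gamma\in K_0(\mathcal D)$ and $m\in\mathbb Z$ let * $\kappa_\gamma$ be the characteristic function of the set of nonzero objects $M$ with $\underline{\dim}M=\gamma$; * ${}^m\kappa^\sigma_\gamma$ be the characteristic function of the set of nonzero $M$ with $\underline{\dim}M=\gamma$ and $\phi^-(M)\in(2m-1,2m+1]$; * ${}^m\delta^\sigma_\gamma$ be the characteristic function of the set of nonzero $M$ with $\underline{\dim}M=\gamma$ and $M\in\mathcal P(\phi)$ for some $\phi\in(2m-1,2m+1]$;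 * $\phi_m(\gamma)$, if $Z(\gamma)\ne0$, be the unique $\phi\in(2m-1,2m+1]$ with $Z(\gamma)\in\mathbb R_{>0}e^{i\pi\phi}$. **Proposition.** For every $\gamma\in K_0(\mathcal D)$, $$\kappa_\gamma=\sum_{\substack{\gamma_1+\dots+\gamma_n=\gamma\\ \phi_{m_1}(\gamma_1)>\dots>\phi_{m_n}(\gamma_n)}}{}^{m_1}\delta^\sigma_{\gamma_1}*\dots*{}^{m_n}\delta^\sigma_{\gamma_n},$$ and for every $m\in\mathbb Z$, $${}^m\kappa^\sigma_\gamma=\sum_{\substack{\gamma_1+\dots+\gamma_n=\gamma,\ m_n=m\\ \phi_{m_1}(\gamma_1)>\dots>\phi_{m_n}(\gamma_n)}}{}^{m_1}\delta^\sigma_{\gamma_1}*\dots*{}^{m_n}\delta^\sigma_{\gamma_n}.$$ The sums run over all $n\ge1$ and all $\gamma_i\in K_0(\mathcal D)$ with $Z(\gamma_i)\neq0$, $m_i\in\mathbb Z$, subject to the displayed conditions. All products occurring are defined, and the sums are locally finite: at each isomorphism class only finitely many summands are nonzero, and the identities are identities of functions on isomorphism classes. -/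

import Mathlib

open CategoryTheory CategoryTheory.Limits CategoryTheory.Pretriangulated

universe w v u

noncomputable section

namespace DerivedHall

section Category

variable (C : Type u) [Category.{v} C] [Preadditive C]

/-- A Krull-Schmidt category: every object is a finite direct sum of objects whose endomorphism
rings are local. -/
def IsKrullSchmidt : Prop :=
  ∀ X : C, ∃ (n : ℕ) (Y : Fin n → C) (b : Bicone Y),
    Nonempty b.IsBilimit ∧ Nonempty (X ≅ b.pt) ∧ ∀ i, IsLocalRing (End (Y i))

/-- Left homological finiteness: `∑_{i ≥ 0} dim_k Hom(X[i], Y) < ∞` for all `X`, `Y`, that is, all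
these spaces are finite dimensional and all but finitely many of them vanish. -/
def IsLeftHomologicallyFinite (k : Type w) [Field k] [Linear k C] [HasShift C ℤ] : Prop :=
  ∀ X Y : C, (∀ i : ℕ, Module.Finite k ((X⟦(i : ℤ)⟧) ⟶ Y)) ∧
    {i : ℕ | Nontrivial ((X⟦(i : ℤ)⟧) ⟶ Y)}.Finite

end Category

section IsoClasses

/-- The isomorphism classes of objects. -/
abbrev IsoClass (C : Type u) [Category.{v} C] : Type u := Quotient (isIsomorphicSetoid C)

variable {C : Type u} [Category.{v} C]

/-- The characteristic function, on isomorphism classes, of a class `R` of objects. -/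
def charFun (R : Set C) : IsoClass C → ℚ :=
  Set.indicator ((fun M : C => (Quotient.mk (isIsomorphicSetoid C) M : IsoClass C)) '' R) 1

/-- The sum over `i ∈ s` of the functions `f i` is locally finite with value `g`: at every
isomorphism class only finitely many terms are nonzero, and they add up to the value of `g`. -/
def IsLocallyFiniteSum {ι : Type*} (s : Set ι) (f : ι → IsoClass C → ℚ) (g : IsoClass C → ℚ) :
    Prop :=
  ∀ X : IsoClass C, {i ∈ s | f i X ≠ 0}.Finite ∧ ∑ᶠ i ∈ s, f i X = g X

end IsoClasses

section Triangulated

variable {C : Type u} [Category.{v} C] [Preadditive C] [HasZeroObject C] [HasShift C ℤ]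
  [∀ n : ℤ, (shiftFunctor C n).Additive] [Pretriangulated C]

variable (C) in
/-- The relations `[Y] - [X] - [Z]` for the distinguished triangles `X ⟶ Y ⟶ Z ⟶ X[1]`. -/
def triangleRelations : Set (FreeAbelianGroup C) :=
  {x | ∃ T ∈ distTriang C,
    x = FreeAbelianGroup.of T.obj₂ - FreeAbelianGroup.of T.obj₁ - FreeAbelianGroup.of T.obj₃}

variable (C) in
/-- The Grothendieck group of a triangulated category. -/
abbrev K0 : Type u := FreeAbelianGroup C ⧸ AddSubgroup.closure (triangleRelations C)

/-- The class of an object in the Grothendieck group. -/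
def dimVec (M : C) : K0 C := QuotientAddGroup.mk (FreeAbelianGroup.of M)

/-! ### Derived Hall numbers and the product -/

/-- The set `(L, N)_{M[1]}` of the morphisms `L ⟶ N` whose cone is isomorphic to `M[1]`. -/
def homsWithCone (L N M : C) : Set (L ⟶ N) :=
  {f | ∃ (g : N ⟶ M⟦(1 : ℤ)⟧) (h : M⟦(1 : ℤ)⟧ ⟶ L⟦(1 : ℤ)⟧), Triangle.mk f g h ∈ distTriang C}

/-- `{L, N} = ∏_{i > 0} |Hom(L[i], N)| ^ ((-1) ^ i)`. -/
def braceFactor (L N : C) : ℚ :=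
  ∏ᶠ (i : ℕ) (_ : 0 < i), (Nat.card ((L⟦(i : ℤ)⟧) ⟶ N) : ℚ) ^ ((-1 : ℤ) ^ i)

/-- The structure constant
`F_{M N}^L = |(L, N)_{M[1]}| / |Aut N| * {L, N} / {N, N}` of the derived Hall algebra. -/
def hallNumber (M N L : C) : ℚ :=
  ((Nat.card (homsWithCone L N M) : ℚ) / (Nat.card (Aut N) : ℚ)) *
    (braceFactor L N / braceFactor N N)

/-- The contribution of the pair `p = ([M], [N])` to the value of `f * g` at `[L]`, that is,
`F_{M N}^L f([M]) g([N])`. The structure constants only depend on isomorphism classes, so they may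
be computed on representatives. -/
def hallTerm (f g : IsoClass C → ℚ) (L : IsoClass C) (p : IsoClass C × IsoClass C) : ℚ :=
  hallNumber p.1.out p.2.out L.out * f p.1 * g p.2

/-- The product `f * g` is defined: only finitely many pairs contribute to each value. -/
def HallMulDefined (f g : IsoClass C → ℚ) : Prop :=
  ∀ L : IsoClass C, (Function.support (hallTerm f g L)).Finite

/-- The product of the derived Hall algebra `u_[M] * u_[N] = ∑_[L] F_{M N}^L u_[L]`, written in
terms of functions on isomorphism classes: `(f * g)([L]) = ∑_{[M], [N]} F_{M N}^L f([M]) g([N])`.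
It is meaningful for functions of possibly infinite support as soon as `HallMulDefined f g`. -/
def hallMul (f g : IsoClass C → ℚ) : IsoClass C → ℚ :=
  fun L => ∑ᶠ p : IsoClass C × IsoClass C, hallTerm f g L p

/-- The unit `u_[0]`: the characteristic function of the zero objects. -/
def hallOne : IsoClass C → ℚ := charFun {M : C | IsZero M}

/-- The iterated product `f_1 * f_2 * ... * f_n`, with `(f_1 * f_2) * f_3` and so on. -/
def hallProd : List (IsoClass C → ℚ) → IsoClass C → ℚ
  | [] => hallOne
  | f :: l => l.foldl hallMul f

/-- Every product formed in `(((f * f_1) * f_2) * ...) * f_n` is defined. -/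
def HallFoldDefined : (IsoClass C → ℚ) → List (IsoClass C → ℚ) → Prop
  | _, [] => True
  | f, g :: l => HallMulDefined f g ∧ HallFoldDefined (hallMul f g) l

/-- Every product formed in `hallProd` is defined. -/
def HallProdDefined : List (IsoClass C → ℚ) → Prop
  | [] => True
  | f :: l => HallFoldDefined f l

/-! ### Stability conditions -/

/-- A Harder-Narasimhan filtration of `M` (of length `n + 1`) with respect to a family `P` of
subcategories: a sequence of triangles `M_i ⟶ M_{i+1} ⟶ A_i ⟶ M_i[1]` from `M_0 = 0` to
`M_{n+1} = M` with nonzero `A_i ∈ P (φ_i)` and strictly decreasing `φ_i`. -/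
structure HNFiltration (P : ℝ → ObjectProperty C) (M : C) where
  n : ℕ
  obj : Fin (n + 2) → C
  factor : Fin (n + 1) → C
  phase : Fin (n + 1) → ℝ
  isZero_bot : IsZero (obj 0)
  topIso : obj (Fin.last (n + 1)) ≅ M
  incl : ∀ i : Fin (n + 1), obj i.castSucc ⟶ obj i.succ
  proj : ∀ i : Fin (n + 1), obj i.succ ⟶ factor i
  conn : ∀ i : Fin (n + 1), factor i ⟶ (obj i.castSucc)⟦(1 : ℤ)⟧
  dist : ∀ i, Triangle.mk (incl i) (proj i) (conn i) ∈ distTriang C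
  mem : ∀ i, P (phase i) (factor i)
  factor_nonzero : ∀ i, ¬ IsZero (factor i)
  phase_anti : StrictAnti phase

variable (C) in
/-- A stability condition `(Z, P)` on a triangulated category. The `P φ` contain zero and are closed
under extensions, hence also under isomorphisms and finite direct sums. -/
structure StabilityCondition where
  Z : K0 C →+ ℂ
  P : ℝ → ObjectProperty C
  zero_mem : ∀ (φ : ℝ) (M : C), IsZero M → P φ M
  ext_mem : ∀ (φ : ℝ), ∀ T ∈ distTriang C, P φ T.obj₁ → P φ T.obj₃ → P φ T.obj₂
  charge : ∀ (φ : ℝ) (M : C), P φ M → ¬ IsZero M →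
    ∃ r : ℝ, 0 < r ∧ Z (dimVec M) = r * Complex.exp (Complex.I * Real.pi * φ)
  shift_iff : ∀ (φ : ℝ) (M : C), P (φ + 1) (M⟦(1 : ℤ)⟧) ↔ P φ M
  hom_zero : ∀ (φ₁ φ₂ : ℝ) (A₁ A₂ : C), φ₂ < φ₁ → P φ₁ A₁ → P φ₂ A₂ → ∀ f : A₁ ⟶ A₂, f = 0
  exists_hn : ∀ M : C, ¬ IsZero M → Nonempty (HNFiltration P M)

/-- The characteristic function `κ_γ` of the nonzero objects of class `γ`. -/
def kappa (γ : K0 C) : IsoClass C → ℚ := charFun {M : C | ¬ IsZero M ∧ dimVec M = γ}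

namespace StabilityCondition

variable (σ : StabilityCondition C)

/-- `φ⁻(M)`: the smallest phase in the Harder-Narasimhan filtration (unique up to isomorphism) of a
nonzero object. -/
def phiMinus (M : C) (hM : ¬ IsZero M) : ℝ :=
  (σ.exists_hn M hM).some.phase (Fin.last _)

/-- The `m`-th window `(2m - 1, 2m + 1]` of phases. -/
def window (m : ℤ) : Set ℝ := Set.Ioc (2 * (m : ℝ) - 1) (2 * (m : ℝ) + 1)

/-- `ᵐκ_γ`: the characteristic function of the nonzero objects `M` of class `γ` with
`φ⁻(M) ∈ (2m - 1, 2m + 1]`. -/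
def kappaAt (m : ℤ) (γ : K0 C) : IsoClass C → ℚ :=
  charFun {M : C | dimVec M = γ ∧ ∃ hM : ¬ IsZero M, σ.phiMinus M hM ∈ window m}

/-- `ᵐδ_γ`: the characteristic function of the semistable (in particular nonzero) objects of class
`γ` whose phase lies in `(2m - 1, 2m + 1]`. -/
def deltaAt (m : ℤ) (γ : K0 C) : IsoClass C → ℚ :=
  charFun {M : C | dimVec M = γ ∧ ¬ IsZero M ∧ ∃ φ ∈ window m, σ.P φ M}

/-- `φ_m(γ)`: the phase of `Z(γ)` in `(2m - 1, 2m + 1]`; meaningful for `Z(γ) ≠ 0`, see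
`phi_eq_iff`. -/
def phi (m : ℤ) (γ : K0 C) : ℝ := 2 * (m : ℝ) + Complex.arg (σ.Z γ) / Real.pi

/-- If `Z(γ) ≠ 0`, then `φ_m(γ)` is the unique `φ ∈ (2m - 1, 2m + 1]` such that `Z(γ)` is a positive
multiple of `exp(iπφ)`. -/
theorem phi_eq_iff (m : ℤ) (γ : K0 C) (hγ : σ.Z γ ≠ 0) (φ : ℝ) :
    σ.phi m γ = φ ↔
      φ ∈ window m ∧ ∃ r : ℝ, 0 < r ∧ σ.Z γ = r * Complex.exp (Complex.I * Real.pi * φ) := by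
  have hpi := Real.pi_pos
  have hexp : ∀ t : ℝ, Complex.exp (Complex.I * Real.pi * (2 * (m : ℝ) + t / Real.pi : ℝ)) =
      Complex.exp (t * Complex.I) := by
    intro t
    have hpi' : (Real.pi : ℂ) ≠ 0 := by exact_mod_cast hpi.ne'
    have : Complex.I * Real.pi * (2 * (m : ℝ) + t / Real.pi : ℝ) =
        t * Complex.I + m * (2 * Real.pi * Complex.I) := by
      push_cast
      field_simp
      ring
    rw [this, Complex.exp_add, Complex.exp_int_mul_two_pi_mul_I, mul_one]
  constructor
  · rintro rfl
    have h1 := Complex.neg_pi_lt_arg (σ.Z γ)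
    have h2 := Complex.arg_le_pi (σ.Z γ)
    refine ⟨⟨?_, ?_⟩, ‖σ.Z γ‖, norm_pos_iff.mpr hγ, ?_⟩
    · have : -1 < Complex.arg (σ.Z γ) / Real.pi := by
        rw [lt_div_iff₀ hpi]; linarith
      unfold phi; linarith
    · have : Complex.arg (σ.Z γ) / Real.pi ≤ 1 := by
        rw [div_le_iff₀ hpi]; linarith
      unfold phi; linarith
    · unfold phi
      rw [hexp, Complex.norm_mul_exp_arg_mul_I]
  · rintro ⟨⟨h1, h2⟩, r, hr, h⟩
    have hφ : φ = 2 * (m : ℝ) + (Real.pi * (φ - 2 * m)) / Real.pi := by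
      field_simp
      ring
    rw [hφ, hexp] at h
    have harg : Complex.arg (σ.Z γ) = Real.pi * (φ - 2 * m) := by
      rw [h, Complex.exp_mul_I]
      exact Complex.arg_mul_cos_add_sin_mul_I hr ⟨by nlinarith, by nlinarith⟩
    unfold phi
    rw [harg, ← hφ]

/-- The index set: sequences `(γ_1, m_1), ..., (γ_n, m_n)` with `n ≥ 1`, `γ_1 + ... + γ_n = γ`, all
`Z(γ_i) ≠ 0` (so that the phases are defined) and `φ_{m_1}(γ_1) > ... > φ_{m_n}(γ_n)`. -/
def decompositions (γ : K0 C) : Set (List (K0 C × ℤ)) :=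
  {l | l ≠ [] ∧ (l.map Prod.fst).sum = γ ∧ (∀ p ∈ l, σ.Z p.1 ≠ 0) ∧
    l.Pairwise (fun p q => σ.phi q.2 q.1 < σ.phi p.2 p.1)}

/-- The subset of the decompositions with `m_n = m`. -/
def decompositionsAt (m : ℤ) (γ : K0 C) : Set (List (K0 C × ℤ)) :=
  {l | l ∈ σ.decompositions γ ∧ ∃ h : l ≠ [], (l.getLast h).2 = m}

/-- The list of factors of `ᵐ¹δ_{γ_1} * ... * ᵐⁿδ_{γ_n}`. -/
def deltaFactors (l : List (K0 C × ℤ)) : List (IsoClass C → ℚ) :=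
  l.map (fun p => σ.deltaAt p.2 p.1)

end StabilityCondition

end Triangulated

end DerivedHall

end

noncomputable section

namespace DerivedHall

/-! ### Characteristic functions on isomorphism classes -/

section IsoClasses

variable {C : Type u} [Category.{v} C]

/-! If `M` collects the Harder-Narasimhan factors of larger phase and `N` is the factor of smallest
phase, then `Hom(M[i], N) = 0` for all `i ≥ 0` (`NonnegHomVanish`), because shifting up only raises
phases. For a triangle `M ⟶ L ⟶ N ⟶ M[1]` this makes `Hom(N[i], N) ⟶ Hom(L[i], N)` bijective for `i
≥ 0`. So `{L, N} = {N, N}`, and `Aut N` acts simply transitively on the morphisms `L ⟶ N` with cone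
`M[1]`: the Hall number is `1` if `L` is such an extension and `0` otherwise (`hallNumber_eq`).

The vanishing also makes `L` determine `M` and `N` (`IsExtension.exists_iso`), so the product of two
characteristic functions is again a characteristic function (`hallMul_charFun`). By induction each
product of the `ᵐδ_γ` along decreasing phases is the characteristic function of one
Harder-Narasimhan stratum (`hallProd_deltaFactors`). Existence and uniqueness of the type
(`exists_stratum_of_hn`, `stratum_unique`) say that the strata partition the nonzero objects, hence
at each class at most one summand is nonzero, and it equals `1`. -/

/-- A class of objects that is closed under isomorphisms. -/
def IsoClosed (R : Set C) : Prop := ∀ ⦃X Y : C⦄, (X ≅ Y) → X ∈ R → Y ∈ R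

theorem nonempty_iso_out (X : C) :
    Nonempty ((Quotient.mk (isIsomorphicSetoid C) X : IsoClass C).out ≅ X) :=
  Quotient.mk_out (s := isIsomorphicSetoid C) X

theorem eq_of_out_iso {X Y : IsoClass C} (e : X.out ≅ Y.out) : X = Y := by
  rw [← Quotient.out_eq X, ← Quotient.out_eq Y]
  exact Quotient.sound (s := isIsomorphicSetoid C) ⟨e⟩

open Classical in
theorem charFun_apply {R : Set C} (hR : IsoClosed R) (X : IsoClass C) :
    charFun R X = if X.out ∈ R then 1 else 0 := by
  have h : X ∈ (fun M : C => (Quotient.mk (isIsomorphicSetoid C) M : IsoClass C)) '' R ↔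
      X.out ∈ R := by
    constructor
    · rintro ⟨M, hM, rfl⟩
      exact hR (nonempty_iso_out M).some.symm hM
    · exact fun h => ⟨X.out, h, Quotient.out_eq X⟩
  simp only [charFun, Set.indicator_apply, h, Pi.one_apply]

/-- If the class `R` is the disjoint union of the classes `T i`, then the characteristic functions
of the `T i` form a locally finite sum with value the characteristic function of `R`. -/
theorem isLocallyFiniteSum_charFun {ι : Type*} {s : Set ι} {f : ι → IsoClass C → ℚ}
    {T : ι → Set C} {R : Set C} (hT : ∀ i ∈ s, IsoClosed (T i))
    (hf : ∀ i ∈ s, f i = charFun (T i)) (hR : ∀ X, X ∈ R ↔ ∃ i ∈ s, X ∈ T i)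
    (huniq : ∀ i ∈ s, ∀ j ∈ s, ∀ X, X ∈ T i → X ∈ T j → i = j) :
    IsLocallyFiniteSum s f (charFun R) := by
  classical
  have hRc : IsoClosed R := by
    intro X Y e hX
    obtain ⟨i, hi, h⟩ := (hR X).1 hX
    exact (hR Y).2 ⟨i, hi, hT i hi e h⟩
  intro X
  have hfX : ∀ i ∈ s, f i X = if X.out ∈ T i then 1 else 0 := fun i hi => by
    rw [hf i hi, charFun_apply (hT i hi)]
  rw [charFun_apply hRc]
  by_cases h : X.out ∈ R
  · obtain ⟨i, hi, hXi⟩ := (hR _).1 h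
    have hzero : ∀ j, j ≠ i → j ∈ s → f j X = 0 := by
      intro j hji hj
      rw [hfX j hj, if_neg fun hXj => hji (huniq j hj i hi _ hXj hXi)]
    refine ⟨(Set.finite_singleton i).subset ?_, ?_⟩
    · rintro j ⟨hj, hne⟩
      by_contra hji
      exact hne (hzero j hji hj)
    · rw [finsum_eq_single _ i, finsum_eq_if, if_pos hi, hfX i hi, if_pos hXi, if_pos h]
      intro j hji
      rw [finsum_eq_if]
      split_ifs with hj
      · exact hzero j hji hj
      · rfl
  · have hzero : ∀ j ∈ s, f j X = 0 := fun j hj => by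
      rw [hfX j hj, if_neg fun hXj => h ((hR _).2 ⟨j, hj, hXj⟩)]
    refine ⟨?_, ?_⟩
    · convert Set.finite_empty
      ext j
      simpa using hzero j
    · rw [if_neg h]
      exact finsum_mem_eq_zero_of_forall_eq_zero hzero

end IsoClasses

/-! ### Finiteness and vanishing of morphisms in nonnegative degrees -/

section Shift

variable {C : Type u} [Category.{v} C] [HasShift C ℤ]

theorem card_aut_ne_zero (hF : ∀ (X Y : C) (i : ℕ), Finite (X⟦(i : ℤ)⟧ ⟶ Y)) (N : C) :
    (Nat.card (Aut N) : ℚ) ≠ 0 := by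
  have := hF N N 0
  have e := (shiftFunctorZero' C ((0 : ℕ) : ℤ) (by simp)).app N
  have : Finite (Aut N) := Finite.of_injective (fun a : Aut N => e.hom ≫ a.hom) fun a b hab =>
    Iso.ext ((cancel_epi e.hom).1 hab)
  exact Nat.cast_ne_zero.2 Nat.card_pos.ne'

variable [Preadditive C]

theorem finite_shift_hom {k : Type w} [Field k] [Finite k] [Linear k C]
    (hfin : IsLeftHomologicallyFinite C k) (X Y : C) (i : ℕ) : Finite (X⟦(i : ℤ)⟧ ⟶ Y) := by
  have := (hfin X Y).1 i
  exact Module.finite_of_finite k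

/-- Each factor is a power of the size of a finite set containing the zero morphism. Nothing about
the support of the product is needed, since a `finprod` of infinite support is `1`. -/
theorem braceFactor_ne_zero (hF : ∀ (X Y : C) (i : ℕ), Finite (X⟦(i : ℤ)⟧ ⟶ Y)) (L N : C) :
    braceFactor L N ≠ 0 := by
  unfold braceFactor
  refine finprod_induction (p := fun x : ℚ => x ≠ 0) one_ne_zero (fun _ _ => mul_ne_zero) fun i =>
    finprod_induction (p := fun x : ℚ => x ≠ 0) one_ne_zero (fun _ _ => mul_ne_zero) fun _ => ?_
  have := hF L N i
  have : Nonempty (L⟦(i : ℤ)⟧ ⟶ N) := ⟨0⟩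
  exact zpow_ne_zero _ (Nat.cast_ne_zero.2 Nat.card_pos.ne')

/-- `Hom(M[i], N) = 0` for all `i ≥ 0`. -/
def NonnegHomVanish (M N : C) : Prop := ∀ (i : ℕ) (f : M⟦(i : ℤ)⟧ ⟶ N), f = 0

namespace NonnegHomVanish

/-- `M[i][1]` is the form in which `M[i + 1]` appears as the last vertex of the `i`-th shift of a
triangle. -/
theorem shift_shift_one {M N : C} (h : NonnegHomVanish M N) (i : ℕ)
    (f : (M⟦(i : ℤ)⟧)⟦(1 : ℤ)⟧ ⟶ N) : f = 0 := by
  have e := (shiftFunctorAdd' C (i : ℤ) 1 ((i + 1 : ℕ) : ℤ) (by push_cast; rfl)).app M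
  have := h (i + 1) (e.hom ≫ f)
  rwa [Preadditive.IsIso.comp_left_eq_zero] at this

theorem zero {M N : C} (h : NonnegHomVanish M N) (f : M ⟶ N) : f = 0 := by
  have e := (shiftFunctorZero' C ((0 : ℕ) : ℤ) (by simp)).app M
  have := h 0 (e.hom ≫ f)
  rwa [Preadditive.IsIso.comp_left_eq_zero] at this

theorem one {M N : C} (h : NonnegHomVanish M N) (f : M⟦(1 : ℤ)⟧ ⟶ N) : f = 0 :=
  h 1 f

end NonnegHomVanish

end Shift

section Triangulated

variable {C : Type u} [Category.{v} C] [Preadditive C] [HasZeroObject C] [HasShift C ℤ]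
  [∀ n : ℤ, (shiftFunctor C n).Additive] [Pretriangulated C]

open scoped ZeroObject

/-! ### Classes in the Grothendieck group -/

theorem dimVec_obj₂ (T : Triangle C) (hT : T ∈ distTriang C) :
    dimVec T.obj₂ = dimVec T.obj₁ + dimVec T.obj₃ := by
  have h : (QuotientAddGroup.mk (FreeAbelianGroup.of T.obj₂ - FreeAbelianGroup.of T.obj₁ -
      FreeAbelianGroup.of T.obj₃) : K0 C) = 0 :=
    (QuotientAddGroup.eq_zero_iff _).2 (AddSubgroup.subset_closure ⟨T, hT, rfl⟩)
  have h' : dimVec T.obj₂ - dimVec T.obj₁ - dimVec T.obj₃ = 0 := h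
  rw [sub_sub, sub_eq_zero] at h'
  exact h'

theorem dimVec_eq_zero {X : C} (hX : IsZero X) : dimVec X = 0 := by
  -- With all three vertices equal to `X`, the relation reads `[X] = [X] + [X]`.
  have h := dimVec_obj₂ (Triangle.mk (𝟙 X) (0 : X ⟶ X) 0)
    ((Triangle.distinguished_iff_of_isZero₃ _ hX).2 (inferInstanceAs (IsIso (𝟙 X))))
  simpa using h

theorem dimVec_congr {X Y : C} (e : X ≅ Y) : dimVec X = dimVec Y := by
  have h := dimVec_obj₂ (Triangle.mk e.hom (0 : Y ⟶ (0 : C)) 0)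
    ((Triangle.distinguished_iff_of_isZero₃ _ (isZero_zero C)).2 (inferInstanceAs (IsIso e.hom)))
  simpa [dimVec_eq_zero (isZero_zero C)] using h.symm

/-! ### Extensions -/

/-- `L` is an extension of `N` by `M`, by means of the morphism `f : L ⟶ N`. -/
def IsExtension (M L N : C) (f : L ⟶ N) : Prop :=
  ∃ (a : M ⟶ L) (c : N ⟶ M⟦(1 : ℤ)⟧), Triangle.mk a f c ∈ distTriang C

/-- Rotation of triangles; the sign it introduces is absorbed by lifting `-h` along the full shift
functor. -/
theorem mem_homsWithCone_iff {M L N : C} (f : L ⟶ N) :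
    f ∈ homsWithCone L N M ↔ IsExtension M L N f := by
  constructor
  · rintro ⟨g, h, hT⟩
    obtain ⟨a, ha⟩ := (shiftFunctor C (1 : ℤ)).map_surjective (-h)
    obtain rfl : h = -(shiftFunctor C (1 : ℤ)).map a := by rw [ha, neg_neg]
    exact ⟨a, g, (rotate_distinguished_triangle _).2 hT⟩
  · rintro ⟨a, c, hT⟩
    exact ⟨c, _, rot_of_distTriang _ hT⟩

namespace IsExtension

variable {M L N : C} {f : L ⟶ N}

/-- `Hom(M, X) = 0` gives existence here, and `Hom(M[1], X) = 0` gives uniqueness in `cancel`: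
together, `f` is universal among morphisms from `L` to such `X`. -/
theorem exists_factor (h : IsExtension M L N f) {X : C} (hv : NonnegHomVanish M X) (u : L ⟶ X) :
    ∃ g : N ⟶ X, u = f ≫ g := by
  obtain ⟨a, c, hT⟩ := h
  exact Triangle.yoneda_exact₂ _ hT u (hv.zero _)

theorem cancel (h : IsExtension M L N f) {X : C} (hv : NonnegHomVanish M X) {u v : N ⟶ X}
    (huv : f ≫ u = f ≫ v) : u = v := by
  obtain ⟨a, c, hT⟩ := h
  have h : f ≫ (u - v) = 0 := by rw [Preadditive.comp_sub, huv, sub_self]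
  obtain ⟨g, hg⟩ : ∃ g : M⟦(1 : ℤ)⟧ ⟶ X, u - v = c ≫ g := Triangle.yoneda_exact₃ _ hT (u - v) h
  rw [← sub_eq_zero, hg, hv.one g, comp_zero]

theorem ne_zero (h : IsExtension M L N f) (hv : NonnegHomVanish M N) (hN : ¬ IsZero N) :
    f ≠ 0 := by
  intro hf
  exact hN ((IsZero.iff_id_eq_zero N).2 (h.cancel hv (by rw [hf, zero_comp, zero_comp])))

/-- An extension whose outer terms have no morphisms in nonnegative degrees determines these
terms. -/
theorem exists_iso {M' N' : C} {f' : L ⟶ N'} (h : IsExtension M L N f)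
    (h' : IsExtension M' L N' f') (hMN : NonnegHomVanish M N) (hMN' : NonnegHomVanish M N')
    (hM'N : NonnegHomVanish M' N) (hM'N' : NonnegHomVanish M' N') :
    Nonempty (M ≅ M') ∧ ∃ e : N ≅ N', f ≫ e.hom = f' := by
  obtain ⟨u, hu⟩ := h.exists_factor hMN' f'
  obtain ⟨w, hw⟩ := h'.exists_factor hM'N f
  let e : N ≅ N' :=
    { hom := u
      inv := w
      hom_inv_id := h.cancel hMN (by rw [← Category.assoc, ← hu, ← hw, Category.comp_id])
      inv_hom_id := h'.cancel hM'N' (by rw [← Category.assoc, ← hw, ← hu, Category.comp_id]) }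
  refine ⟨?_, e, hu.symm⟩
  obtain ⟨a, c, hT⟩ := h
  obtain ⟨a', c', hT'⟩ := h'
  have hu' : f ≫ u = 𝟙 L ≫ f' := by rw [← hu, Category.id_comp]
  obtain ⟨t, ht₁, ht₂⟩ := complete_distinguished_triangle_morphism₁ _ _ hT hT' (𝟙 L) u hu'
  let φ : Triangle.mk a f c ⟶ Triangle.mk a' f' c' :=
    { hom₁ := t
      hom₂ := 𝟙 L
      hom₃ := u
      comm₁ := ht₁
      comm₂ := hu'
      comm₃ := ht₂ }
  have hL : IsIso (𝟙 L) := inferInstance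
  have he : IsIso e.hom := e.isIso_hom
  -- The universal property only compares the targets; the fibres are compared by completing to a
  -- morphism of triangles.
  have ht : IsIso (X := M) (Y := M') t := isIso₁_of_isIso₂₃ φ hT hT' hL he
  exact ⟨asIso (X := M) (Y := M') t⟩

theorem congr {M' L' N' : C} (h : IsExtension M L N f) (eM : M ≅ M') (eL : L ≅ L')
    (eN : N ≅ N') : IsExtension M' L' N' (eL.inv ≫ f ≫ eN.hom) := by
  obtain ⟨a, c, hT⟩ := h
  have h₁ : (eM.inv ≫ a ≫ eL.hom) ≫ eL.inv = eM.inv ≫ a := by simp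
  have h₂ : (eL.inv ≫ f ≫ eN.hom) ≫ eN.inv = eL.inv ≫ f := by simp
  have h₃ : (eN.inv ≫ c ≫ eM.hom⟦(1 : ℤ)⟧') ≫ eM.inv⟦(1 : ℤ)⟧' = eN.inv ≫ c := by
    have h₀ : eM.hom⟦(1 : ℤ)⟧' ≫ eM.inv⟦(1 : ℤ)⟧' = 𝟙 _ :=
      ((shiftFunctor C (1 : ℤ)).mapIso eM).hom_inv_id
    rw [Category.assoc, Category.assoc, h₀, Category.comp_id]
  exact ⟨eM.inv ≫ a ≫ eL.hom, eN.inv ≫ c ≫ eM.hom⟦(1 : ℤ)⟧', isomorphic_distinguished _ hT _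
    (Triangle.isoMk _ _ eM.symm eL.symm eN.symm h₁ h₂ h₃)⟩

/-- The morphisms with cone `M[1]` form a torsor under the automorphisms of the target. -/
theorem card_homsWithCone (h : IsExtension M L N f) (hv : NonnegHomVanish M N) :
    Nat.card (homsWithCone L N M) = Nat.card (Aut N) := by
  refine (Nat.card_congr (Equiv.ofBijective
    (fun e : Aut N => (⟨f ≫ e.hom, (mem_homsWithCone_iff _).2 ?_⟩ : homsWithCone L N M))
    ⟨?_, ?_⟩)).symm
  · simpa using h.congr (Iso.refl M) (Iso.refl L) e
  · intro e e' hee'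
    exact Iso.ext (h.cancel hv (congrArg Subtype.val hee'))
  · rintro ⟨f', hf'⟩
    obtain ⟨-, e, he⟩ := h.exists_iso ((mem_homsWithCone_iff _).1 hf') hv hv hv hv
    exact ⟨e, Subtype.ext he⟩

/-- In the long exact sequence of `Hom(-, N)`, the neighbouring terms `Hom(M[i + 1], N)` and
`Hom(M[i], N)` vanish. The shifted triangle carries the sign `(-1)^i`, which is moved onto `g`. -/
theorem shift_bijective (h : IsExtension M L N f) (hv : NonnegHomVanish M N) (i : ℕ) :
    Function.Bijective fun g : N⟦(i : ℤ)⟧ ⟶ N => f⟦(i : ℤ)⟧' ≫ g := by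
  obtain ⟨a, c, hT⟩ := h
  have hT' := Triangle.shift_distinguished _ hT (i : ℤ)
  constructor
  · intro g g' hgg'
    have h₀ : ((i : ℤ).negOnePow • f⟦(i : ℤ)⟧') ≫ (g - g') = 0 := by
      rw [Linear.units_smul_comp, Preadditive.comp_sub, sub_eq_zero.2 hgg', smul_zero]
    obtain ⟨t, ht⟩ := Triangle.yoneda_exact₃ _ hT' (X := N) (g - g') h₀
    obtain rfl : t = 0 := hv.shift_shift_one i t
    exact sub_eq_zero.1 (ht.trans comp_zero)
  · intro u
    obtain ⟨g, hg⟩ : ∃ g : N⟦(i : ℤ)⟧ ⟶ N, u = ((i : ℤ).negOnePow • f⟦(i : ℤ)⟧') ≫ g :=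
      Triangle.yoneda_exact₂ _ hT' (X := N) u (hv i _)
    refine ⟨(i : ℤ).negOnePow • g, ?_⟩
    rw [hg]
    simp

theorem braceFactor_eq (h : IsExtension M L N f) (hv : NonnegHomVanish M N) :
    braceFactor L N = braceFactor N N := by
  unfold braceFactor
  refine finprod_congr fun i => finprod_congr fun _ => ?_
  rw [Nat.card_congr (Equiv.ofBijective _ (h.shift_bijective hv i))]

end IsExtension

open Classical in
theorem hallNumber_eq (hF : ∀ (X Y : C) (i : ℕ), Finite (X⟦(i : ℤ)⟧ ⟶ Y)) {M N : C}
    (hv : NonnegHomVanish M N) (L : C) :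
    hallNumber M N L = if ∃ f, IsExtension M L N f then 1 else 0 := by
  unfold hallNumber
  split_ifs with h
  · obtain ⟨f, h⟩ := h
    rw [h.card_homsWithCone hv, h.braceFactor_eq hv, div_self (card_aut_ne_zero hF N),
      div_self (braceFactor_ne_zero hF N N), one_mul]
  · have : IsEmpty (homsWithCone L N M) :=
      ⟨fun f => h ⟨f.1, (mem_homsWithCone_iff _).1 f.2⟩⟩
    simp

/-! ### Products of characteristic functions -/

/-- The class of the extensions of objects of `S` by objects of `R`. -/
def extensions (R S : Set C) : Set C := {L | ∃ M ∈ R, ∃ N ∈ S, ∃ f, IsExtension M L N f}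

theorem isoClosed_extensions (R S : Set C) : IsoClosed (extensions R S) := by
  rintro X Y e ⟨M, hM, N, hN, f, h⟩
  exact ⟨M, hM, N, hN, _, h.congr (Iso.refl M) e (Iso.refl N)⟩

section Product

variable {R S : Set C}

open Classical in
theorem hallTerm_charFun (hF : ∀ (X Y : C) (i : ℕ), Finite (X⟦(i : ℤ)⟧ ⟶ Y)) (hR : IsoClosed R)
    (hS : IsoClosed S) (hv : ∀ M ∈ R, ∀ N ∈ S, NonnegHomVanish M N) (L : IsoClass C)
    (p : IsoClass C × IsoClass C) :
    hallTerm (charFun R) (charFun S) L p =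
      if p.1.out ∈ R ∧ p.2.out ∈ S ∧ ∃ f, IsExtension p.1.out L.out p.2.out f then 1 else 0 := by
  unfold hallTerm
  rw [charFun_apply hR, charFun_apply hS]
  by_cases h₁ : p.1.out ∈ R <;> by_cases h₂ : p.2.out ∈ S <;>
    simp only [h₁, h₂, if_true, if_false, mul_zero, mul_one, true_and, false_and]
  exact hallNumber_eq hF (hv _ h₁ _ h₂) _

/-- Both pairs present the same `L` as an extension, and `IsExtension.exists_iso` identifies their
terms. This gives at once that the product is defined and that its values are `0` or `1`. -/
theorem eq_of_hallTerm_ne_zero (hF : ∀ (X Y : C) (i : ℕ), Finite (X⟦(i : ℤ)⟧ ⟶ Y))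
    (hR : IsoClosed R) (hS : IsoClosed S) (hv : ∀ M ∈ R, ∀ N ∈ S, NonnegHomVanish M N)
    {L : IsoClass C} {p q : IsoClass C × IsoClass C}
    (hp : hallTerm (charFun R) (charFun S) L p ≠ 0)
    (hq : hallTerm (charFun R) (charFun S) L q ≠ 0) : p = q := by
  classical
  rw [hallTerm_charFun hF hR hS hv] at hp hq
  obtain ⟨hp₁, hp₂, f, hf⟩ := not_not.1 fun h => hp (if_neg h)
  obtain ⟨hq₁, hq₂, g, hg⟩ := not_not.1 fun h => hq (if_neg h)
  obtain ⟨⟨e₁⟩, e₂, -⟩ := hf.exists_iso hg (hv _ hp₁ _ hp₂) (hv _ hp₁ _ hq₂) (hv _ hq₁ _ hp₂)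
    (hv _ hq₁ _ hq₂)
  exact Prod.ext (eq_of_out_iso e₁) (eq_of_out_iso e₂)

theorem hallMulDefined_charFun (hF : ∀ (X Y : C) (i : ℕ), Finite (X⟦(i : ℤ)⟧ ⟶ Y))
    (hR : IsoClosed R) (hS : IsoClosed S) (hv : ∀ M ∈ R, ∀ N ∈ S, NonnegHomVanish M N) :
    HallMulDefined (charFun R) (charFun S) := fun _ =>
  Set.Subsingleton.finite fun _ hp _ hq => eq_of_hallTerm_ne_zero hF hR hS hv hp hq

theorem hallMul_charFun (hF : ∀ (X Y : C) (i : ℕ), Finite (X⟦(i : ℤ)⟧ ⟶ Y))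
    (hR : IsoClosed R) (hS : IsoClosed S) (hv : ∀ M ∈ R, ∀ N ∈ S, NonnegHomVanish M N) :
    hallMul (charFun R) (charFun S) = charFun (extensions R S) := by
  classical
  ext L
  unfold hallMul
  rw [charFun_apply (isoClosed_extensions R S)]
  split_ifs with h
  · obtain ⟨M, hM, N, hN, f, h⟩ := h
    obtain ⟨eM⟩ := nonempty_iso_out M
    obtain ⟨eN⟩ := nonempty_iso_out N
    have hp := hallTerm_charFun hF hR hS hv L (Quotient.mk _ M, Quotient.mk _ N)
    rw [if_pos ⟨hR eM.symm hM, hS eN.symm hN, _, h.congr eM.symm (Iso.refl _) eN.symm⟩] at hp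
    rw [finsum_eq_single _ (Quotient.mk _ M, Quotient.mk _ N), hp]
    intro q hq
    by_contra hne
    exact hq (eq_of_hallTerm_ne_zero hF hR hS hv hne (by rw [hp]; exact one_ne_zero))
  · refine finsum_eq_zero_of_forall_eq_zero fun p => ?_
    rw [hallTerm_charFun hF hR hS hv, if_neg]
    rintro ⟨h₁, h₂, hf⟩
    exact h ⟨_, h₁, _, h₂, hf⟩

end Product

/-- Products associate to the left, so an induction along them must split off the last factor. -/
theorem hallFoldDefined_append_singleton (f : IsoClass C → ℚ) (l : List (IsoClass C → ℚ))
    (g : IsoClass C → ℚ) :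
    HallFoldDefined f (l ++ [g]) ↔ HallFoldDefined f l ∧ HallMulDefined (l.foldl hallMul f) g := by
  induction l generalizing f with
  | nil => simp [HallFoldDefined]
  | cons a l ih => simp [HallFoldDefined, ih, and_assoc]

theorem hallProdDefined_append_singleton {l : List (IsoClass C → ℚ)} (hl : l ≠ [])
    (g : IsoClass C → ℚ) :
    HallProdDefined (l ++ [g]) ↔ HallProdDefined l ∧ HallMulDefined (hallProd l) g := by
  cases l with
  | nil => exact absurd rfl hl
  | cons f l => exact hallFoldDefined_append_singleton f l g

theorem hallProd_append_singleton {l : List (IsoClass C → ℚ)} (hl : l ≠ [])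
    (g : IsoClass C → ℚ) : hallProd (l ++ [g]) = hallMul (hallProd l) g := by
  cases l with
  | nil => exact absurd rfl hl
  | cons f l => simp [hallProd]

/-! ### Harder-Narasimhan strata -/

namespace StabilityCondition

variable (σ : StabilityCondition C)

theorem P_congr {φ : ℝ} {X Y : C} (e : X ≅ Y) (hX : σ.P φ X) : σ.P φ Y :=
  σ.ext_mem φ (Triangle.mk e.hom (0 : Y ⟶ (0 : C)) 0)
    ((Triangle.distinguished_iff_of_isZero₃ _ (isZero_zero C)).2 (inferInstanceAs (IsIso e.hom)))
    hX (σ.zero_mem φ _ (isZero_zero C))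

theorem P_shift {φ : ℝ} {X : C} (hX : σ.P φ X) (i : ℕ) : σ.P (φ + i) (X⟦(i : ℤ)⟧) := by
  induction i with
  | zero =>
    have e := (shiftFunctorZero' C ((0 : ℕ) : ℤ) (by simp)).app X
    simpa using σ.P_congr e.symm hX
  | succ i ih =>
    have e := (shiftFunctorAdd' C (i : ℤ) 1 ((i + 1 : ℕ) : ℤ) (by push_cast; rfl)).app X
    have h := σ.P_congr e.symm ((σ.shift_iff _ _).2 ih)
    rwa [show φ + i + 1 = φ + (i + 1 : ℕ) by push_cast; ring] at h

theorem nonnegHomVanish_of_lt {φ ψ : ℝ} (h : φ < ψ) {M N : C} (hM : σ.P ψ M) (hN : σ.P φ N) :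
    NonnegHomVanish M N := fun i f =>
  σ.hom_zero (ψ + i) φ _ _ (by linarith [i.cast_nonneg (α := ℝ)]) (σ.P_shift hM i) hN f

/-- The semistable objects of class `p.1` with phase in the `p.2`-th window. -/
def semistables (p : K0 C × ℤ) : Set C :=
  {M : C | dimVec M = p.1 ∧ ¬ IsZero M ∧ ∃ φ ∈ window p.2, σ.P φ M}

theorem isoClosed_semistables (p : K0 C × ℤ) : IsoClosed (σ.semistables p) := by
  rintro X Y e ⟨h₁, h₂, φ, hφ, h₃⟩
  exact ⟨(dimVec_congr e).symm.trans h₁, fun h => h₂ (h.of_iso e), φ, hφ, σ.P_congr e h₃⟩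

theorem charge_ne_zero {φ : ℝ} {M : C} (hM : σ.P φ M) (h₀ : ¬ IsZero M) :
    σ.Z (dimVec M) ≠ 0 := by
  obtain ⟨r, hr, h⟩ := σ.charge φ M hM h₀
  rw [h]
  exact mul_ne_zero (by exact_mod_cast hr.ne') (Complex.exp_ne_zero _)

theorem phi_dimVec {m : ℤ} {φ : ℝ} {M : C} (hφ : φ ∈ window m) (hM : σ.P φ M)
    (h₀ : ¬ IsZero M) : σ.phi m (dimVec M) = φ :=
  (σ.phi_eq_iff m _ (σ.charge_ne_zero hM h₀) φ).2 ⟨hφ, σ.charge φ M hM h₀⟩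

theorem P_phi {p : K0 C × ℤ} {M : C} (hM : M ∈ σ.semistables p) : σ.P (σ.phi p.2 p.1) M := by
  obtain ⟨h₁, h₂, φ, hφ, h₃⟩ := hM
  rwa [← h₁, σ.phi_dimVec hφ h₃ h₂]

theorem window_injective {m m' : ℤ} {φ : ℝ} (h : φ ∈ window m) (h' : φ ∈ window m') : m = m' := by
  obtain ⟨h₁, h₂⟩ := h
  obtain ⟨h₃, h₄⟩ := h'
  have h₅ : (m : ℝ) < m' + 1 := by linarith
  have h₆ : (m' : ℝ) < m + 1 := by linarith
  norm_cast at h₅ h₆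
  omega

theorem exists_mem_window (φ : ℝ) : ∃ m : ℤ, φ ∈ window m := by
  refine ⟨⌈(φ - 1) / 2⌉, ?_, ?_⟩
  · linarith [Int.ceil_lt_add_one ((φ - 1) / 2)]
  · linarith [Int.le_ceil ((φ - 1) / 2)]

/-- The objects whose Harder-Narasimhan filtration has the type prescribed by a list, which starts
with the factor of smallest phase. -/
def stratum : List (K0 C × ℤ) → Set C
  | [] => {M : C | IsZero M}
  | p :: l => extensions (stratum l) (σ.semistables p)

theorem isoClosed_stratum (l : List (K0 C × ℤ)) : IsoClosed (σ.stratum l) := by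
  cases l with
  | nil => exact fun X Y e hX => IsZero.of_iso hX e.symm
  | cons p l => exact isoClosed_extensions _ _

/-- The base case for products: `hallProd [f]` is `f` itself, without multiplication by the unit. -/
theorem stratum_singleton (p : K0 C × ℤ) : σ.stratum [p] = σ.semistables p := by
  ext L
  constructor
  · rintro ⟨M, hM, N, hN, f, a, c, hT⟩
    have hf : IsIso f := (Triangle.isZero₁_iff_isIso₂ _ hT).1 hM
    exact σ.isoClosed_semistables p (asIso f).symm hN
  · intro hL
    have h : IsIso (𝟙 L) := inferInstance
    exact ⟨0, isZero_zero C, L, hL, 𝟙 L, 0, 0,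
      (Triangle.distinguished_iff_of_isZero₁ _ (isZero_zero C)).2 h⟩

/-- Dévissage: a morphism from `L[i]` vanishes on the part of larger phases by induction, so it
factors through the shifted semistable quotient, where phases decide. -/
theorem nonnegHomVanish_stratum {l : List (K0 C × ℤ)} {φ : ℝ} (h : ∀ p ∈ l, φ < σ.phi p.2 p.1)
    {M N : C} (hM : M ∈ σ.stratum l) (hN : σ.P φ N) : NonnegHomVanish M N := by
  induction l generalizing M with
  | nil => exact fun i f => ((shiftFunctor C (i : ℤ)).map_isZero hM).eq_zero_of_src f
  | cons p l ih =>
    obtain ⟨A, hA, B, hB, f, hf⟩ := hM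
    have hAN := ih (fun q hq => h q (List.mem_cons_of_mem _ hq)) hA
    have hBN := σ.nonnegHomVanish_of_lt (h p List.mem_cons_self) (σ.P_phi hB) hN
    intro i u
    obtain ⟨a, c, hT⟩ := hf
    obtain ⟨g, hg⟩ := Triangle.yoneda_exact₂ _ (Triangle.shift_distinguished _ hT (i : ℤ))
      (X := N) u (hAN i _)
    obtain rfl : g = 0 := hBN i g
    exact hg.trans comp_zero

theorem nonnegHomVanish_stratum_semistables {p : K0 C × ℤ} {l : List (K0 C × ℤ)}
    (h : ∀ q ∈ l, σ.phi p.2 p.1 < σ.phi q.2 q.1) :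
    ∀ M ∈ σ.stratum l, ∀ N ∈ σ.semistables p, NonnegHomVanish M N :=
  fun _ hM _ hN => σ.nonnegHomVanish_stratum h hM (σ.P_phi hN)

/-- The phases of a list increase strictly. -/
def PhaseIncreasing (l : List (K0 C × ℤ)) : Prop :=
  l.Pairwise fun p q => σ.phi p.2 p.1 < σ.phi q.2 q.1

/-- A nonzero morphism from an object of a stratum to a semistable object shows that the phase of
the latter is at least the smallest phase of the stratum. -/
theorem phi_le_of_mem_stratum {p q : K0 C × ℤ} {l l' : List (K0 C × ℤ)}
    (hl : σ.PhaseIncreasing (p :: l)) (hl' : σ.PhaseIncreasing (q :: l')) {L : C}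
    (hL : L ∈ σ.stratum (p :: l)) (hL' : L ∈ σ.stratum (q :: l')) :
    σ.phi p.2 p.1 ≤ σ.phi q.2 q.1 := by
  by_contra! hlt
  obtain ⟨M, hM, N, hN, f, hf⟩ := hL'
  have hMN := σ.nonnegHomVanish_stratum_semistables (List.pairwise_cons.1 hl').1 M hM N hN
  refine hf.ne_zero hMN hN.2.1 ((σ.nonnegHomVanish_stratum ?_ hL (σ.P_phi hN)).zero f)
  intro r hr
  rcases List.mem_cons.1 hr with rfl | hr
  · exact hlt
  · exact hlt.trans ((List.pairwise_cons.1 hl).1 r hr)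

theorem not_isZero_of_mem_stratum_cons {p : K0 C × ℤ} {l : List (K0 C × ℤ)}
    (hl : σ.PhaseIncreasing (p :: l)) {L : C} (hL : L ∈ σ.stratum (p :: l)) : ¬ IsZero L := by
  intro h
  obtain ⟨M, hM, N, hN, f, hf⟩ := hL
  exact hf.ne_zero (σ.nonnegHomVanish_stratum_semistables (List.pairwise_cons.1 hl).1 M hM N hN)
    hN.2.1 (h.eq_zero_of_src f)

theorem dimVec_of_mem_stratum {l : List (K0 C × ℤ)} {L : C} (hL : L ∈ σ.stratum l) :
    dimVec L = (l.map Prod.fst).sum := by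
  induction l generalizing L with
  | nil => exact dimVec_eq_zero hL
  | cons p l ih =>
    obtain ⟨M, hM, N, hN, f, a, c, hT⟩ := hL
    rw [List.map_cons, List.sum_cons, ← ih hM, ← hN.1, add_comm]
    exact dimVec_obj₂ _ hT

/-- The type of the Harder-Narasimhan filtration of an object is unique. -/
theorem stratum_unique {l l' : List (K0 C × ℤ)} (hl : σ.PhaseIncreasing l)
    (hl' : σ.PhaseIncreasing l') {L : C} (hL : L ∈ σ.stratum l) (hL' : L ∈ σ.stratum l') :
    l = l' := by
  induction l generalizing l' L with
  | nil =>
    cases l' with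
    | nil => rfl
    | cons p' l' => exact absurd hL (σ.not_isZero_of_mem_stratum_cons hl' hL')
  | cons p l ih =>
    cases l' with
    | nil => exact absurd hL' (σ.not_isZero_of_mem_stratum_cons hl hL)
    | cons p' l' =>
      have hφ := le_antisymm (σ.phi_le_of_mem_stratum hl hl' hL hL')
        (σ.phi_le_of_mem_stratum hl' hl hL' hL)
      obtain ⟨M, hM, N, hN, f, hf⟩ := hL
      obtain ⟨M', hM', N', hN', f', hf'⟩ := hL'
      have hlt := (List.pairwise_cons.1 hl).1
      have hlt' := (List.pairwise_cons.1 hl').1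
      obtain ⟨⟨eM⟩, eN, -⟩ := hf.exists_iso hf'
        -- Equality of the smallest phases supplies the two mixed vanishing conditions.
        (σ.nonnegHomVanish_stratum hlt hM (σ.P_phi hN))
        (σ.nonnegHomVanish_stratum hlt hM (hφ ▸ σ.P_phi hN'))
        (σ.nonnegHomVanish_stratum hlt' hM' (hφ ▸ σ.P_phi hN))
        (σ.nonnegHomVanish_stratum hlt' hM' (σ.P_phi hN'))
      have h₁ : p.1 = p'.1 := by rw [← hN.1, ← hN'.1, dimVec_congr eN]
      -- For equal classes the two phases differ by `2 (p.2 - p'.2)`.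
      have h₂ : p.2 = p'.2 := by
        rw [h₁] at hφ
        unfold phi at hφ
        have : (p.2 : ℝ) = p'.2 := by linarith
        exact_mod_cast this
      rw [Prod.ext h₁ h₂, ih hl.of_cons hl'.of_cons hM
        (σ.isoClosed_stratum l' eM.symm hM')]

/-- The type of a Harder-Narasimhan filtration. -/
theorem exists_stratum_of_hn {M : C} (F : HNFiltration σ.P M) :
    ∃ (p : K0 C × ℤ) (l : List (K0 C × ℤ)), M ∈ σ.stratum (p :: l) ∧
      σ.PhaseIncreasing (p :: l) ∧ (∀ q ∈ p :: l, σ.Z q.1 ≠ 0) ∧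
      F.phase (Fin.last F.n) ∈ window p.2 := by
  -- The fourth clause traces each phase to an index below `j`, so that the next factor has strictly
  -- smaller phase. The last clause records the window of the newest factor, which at the top
  -- contains the smallest phase.
  have key : ∀ (j : ℕ) (hj : j < F.n + 2), ∃ l : List (K0 C × ℤ),
      F.obj ⟨j, hj⟩ ∈ σ.stratum l ∧ σ.PhaseIncreasing l ∧ (∀ q ∈ l, σ.Z q.1 ≠ 0) ∧
      (∀ q ∈ l, ∃ i : Fin (F.n + 1), i.val < j ∧ σ.phi q.2 q.1 = F.phase i) ∧
      ∀ i : Fin (F.n + 1), i.val + 1 = j → ∃ p t, l = p :: t ∧ F.phase i ∈ window p.2 := by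
    intro j
    induction j with
    | zero =>
      exact fun _ => ⟨[], F.isZero_bot, List.Pairwise.nil, by simp, by simp, by simp⟩
    | succ j ih =>
      intro hj
      obtain ⟨l, h₁, h₂, h₃, h₄, -⟩ := ih (by omega)
      let i : Fin (F.n + 1) := ⟨j, by omega⟩
      obtain ⟨m, hm⟩ := exists_mem_window (F.phase i)
      have hphi := σ.phi_dimVec hm (F.mem i) (F.factor_nonzero i)
      refine ⟨(dimVec (F.factor i), m) :: l, ?_, ?_, ?_, ?_, ?_⟩
      · exact ⟨_, h₁, F.factor i, ⟨rfl, F.factor_nonzero i, _, hm, F.mem i⟩, F.proj i, F.incl i,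
          F.conn i, F.dist i⟩
      · refine List.pairwise_cons.2 ⟨fun q hq => ?_, h₂⟩
        obtain ⟨i', hi', hq'⟩ := h₄ q hq
        rw [hq']
        exact hphi.trans_lt (F.phase_anti hi')
      · intro q hq
        rcases List.mem_cons.1 hq with rfl | hq
        · exact σ.charge_ne_zero (F.mem i) (F.factor_nonzero i)
        · exact h₃ q hq
      · intro q hq
        rcases List.mem_cons.1 hq with rfl | hq
        · exact ⟨i, Nat.lt_succ_self j, hphi⟩
        · obtain ⟨i', hi', hq'⟩ := h₄ q hq
          exact ⟨i', by omega, hq'⟩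
      · intro i' hi'
        obtain rfl : i' = i := Fin.ext (by simpa using hi')
        exact ⟨_, _, rfl, hm⟩
  obtain ⟨l, h₁, h₂, h₃, -, h₅⟩ := key (F.n + 1) (by omega)
  obtain ⟨p, t, rfl, hp⟩ := h₅ (Fin.last F.n) rfl
  exact ⟨p, t, σ.isoClosed_stratum _ F.topIso h₁, h₂, h₃, hp⟩

/-- The product of the functions `ᵐδ_γ` along decreasing phases is defined, and it is the
characteristic function of a Harder-Narasimhan stratum. -/
theorem hallProd_deltaFactors (hF : ∀ (X Y : C) (i : ℕ), Finite (X⟦(i : ℤ)⟧ ⟶ Y))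
    {l : List (K0 C × ℤ)} (hl : σ.PhaseIncreasing l) :
    HallProdDefined (σ.deltaFactors l.reverse) ∧
      hallProd (σ.deltaFactors l.reverse) = charFun (σ.stratum l) := by
  induction l with
  | nil => exact ⟨trivial, rfl⟩
  | cons p l ih =>
    have happ : σ.deltaFactors (p :: l).reverse =
        σ.deltaFactors l.reverse ++ [charFun (σ.semistables p)] := by
      simp only [deltaFactors, List.reverse_cons, List.map_append, List.map_singleton]
      rfl
    rw [happ]
    rcases eq_or_ne l [] with rfl | hne
    · rw [stratum_singleton]
      exact ⟨trivial, rfl⟩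
    · obtain ⟨ih₁, ih₂⟩ := ih hl.of_cons
      have hne' : σ.deltaFactors l.reverse ≠ [] := by simpa [deltaFactors] using hne
      have hv := σ.nonnegHomVanish_stratum_semistables (List.pairwise_cons.1 hl).1
      rw [hallProdDefined_append_singleton hne', hallProd_append_singleton hne', ih₂]
      exact ⟨⟨ih₁, hallMulDefined_charFun hF (σ.isoClosed_stratum l) (σ.isoClosed_semistables p)
        hv⟩, hallMul_charFun hF (σ.isoClosed_stratum l) (σ.isoClosed_semistables p) hv⟩

theorem phaseIncreasing_reverse {γ : K0 C} {l : List (K0 C × ℤ)} (hl : l ∈ σ.decompositions γ) :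
    σ.PhaseIncreasing l.reverse :=
  List.pairwise_reverse.2 hl.2.2.2

theorem reverse_mem_decompositions {p : K0 C × ℤ} {l : List (K0 C × ℤ)} {M : C}
    (hM : M ∈ σ.stratum (p :: l)) (hl : σ.PhaseIncreasing (p :: l))
    (hZ : ∀ q ∈ p :: l, σ.Z q.1 ≠ 0) : (p :: l).reverse ∈ σ.decompositions (dimVec M) := by
  refine ⟨by simp, ?_, fun q hq => hZ q (List.mem_reverse.1 hq), List.pairwise_reverse.2 hl⟩
  rw [σ.dimVec_of_mem_stratum hM, List.map_reverse, List.sum_reverse]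

theorem mem_kappa_iff (γ : K0 C) (M : C) :
    (¬ IsZero M ∧ dimVec M = γ) ↔ ∃ l ∈ σ.decompositions γ, M ∈ σ.stratum l.reverse := by
  constructor
  · rintro ⟨hM, rfl⟩
    obtain ⟨p, l, h, hl, hZ, -⟩ := σ.exists_stratum_of_hn (σ.exists_hn M hM).some
    exact ⟨_, σ.reverse_mem_decompositions h hl hZ, by simpa using h⟩
  · rintro ⟨l, hl, hM⟩
    have hinc := σ.phaseIncreasing_reverse hl
    refine ⟨?_, ?_⟩
    · obtain ⟨p, t, hpt⟩ := List.exists_cons_of_ne_nil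
        (show l.reverse ≠ [] by simpa using hl.1)
      rw [hpt] at hM hinc
      exact σ.not_isZero_of_mem_stratum_cons hinc hM
    · rw [σ.dimVec_of_mem_stratum hM, List.map_reverse, List.sum_reverse, hl.2.1]

/-- The head of a stratum list is the last entry of the decomposition, so its window is the one
containing `φ⁻`. -/
theorem mem_kappaAt_iff (m : ℤ) (γ : K0 C) (M : C) :
    (dimVec M = γ ∧ ∃ hM : ¬ IsZero M, σ.phiMinus M hM ∈ window m) ↔
      ∃ l ∈ σ.decompositionsAt m γ, M ∈ σ.stratum l.reverse := by
  constructor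
  · rintro ⟨rfl, hM, hm⟩
    obtain ⟨p, l, h, hl, hZ, hp⟩ := σ.exists_stratum_of_hn (σ.exists_hn M hM).some
    refine ⟨_, ⟨σ.reverse_mem_decompositions h hl hZ, by simp, ?_⟩, by simpa using h⟩
    simpa using window_injective hp hm
  · rintro ⟨l, ⟨hl, hne, hlast⟩, hMl⟩
    obtain ⟨hM, rfl⟩ := (σ.mem_kappa_iff γ M).2 ⟨l, hl, hMl⟩
    obtain ⟨p, t, h, ht, -, hp⟩ := σ.exists_stratum_of_hn (σ.exists_hn M hM).some
    -- `phiMinus` refers to a chosen filtration; uniqueness of the type identifies the given `l`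
    -- with the type of that choice.
    have hlt : l = (p :: t).reverse := by
      rw [← σ.stratum_unique (σ.phaseIncreasing_reverse hl) ht hMl h, List.reverse_reverse]
    subst hlt
    have hpm : p.2 = m := by simpa using hlast
    exact ⟨rfl, hM, hpm ▸ hp⟩

end StabilityCondition

end Triangulated

end DerivedHall

end

theorem mainTheorem3 {k : Type w} [Field k] [Finite k]
    {C : Type u} [Category.{v} C] [Preadditive C] [Linear k C] [HasZeroObject C] [HasShift C ℤ]
    [∀ n : ℤ, (shiftFunctor C n).Additive] [∀ n : ℤ, (shiftFunctor C n).Linear k]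
    [Pretriangulated C] [IsTriangulated C]
    (hKS : DerivedHall.IsKrullSchmidt C)
    (hfin : DerivedHall.IsLeftHomologicallyFinite C k)
    (σ : DerivedHall.StabilityCondition C) (γ : DerivedHall.K0 C) :
    (∀ l ∈ σ.decompositions γ, DerivedHall.HallProdDefined (σ.deltaFactors l)) ∧
    DerivedHall.IsLocallyFiniteSum (σ.decompositions γ)
      (fun l => DerivedHall.hallProd (σ.deltaFactors l)) (DerivedHall.kappa γ) ∧
    ∀ m : ℤ, DerivedHall.IsLocallyFiniteSum (σ.decompositionsAt m γ)
      (fun l => DerivedHall.hallProd (σ.deltaFactors l)) (σ.kappaAt m γ) := by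
  have hF := DerivedHall.finite_shift_hom hfin
  have hprod : ∀ l ∈ σ.decompositions γ, DerivedHall.HallProdDefined (σ.deltaFactors l) ∧
      DerivedHall.hallProd (σ.deltaFactors l) = DerivedHall.charFun (σ.stratum l.reverse) := by
    intro l hl
    have h := σ.hallProd_deltaFactors hF (σ.phaseIncreasing_reverse hl)
    rwa [List.reverse_reverse] at h
  have huniq : ∀ l ∈ σ.decompositions γ, ∀ l' ∈ σ.decompositions γ, ∀ X : C,
      X ∈ σ.stratum l.reverse → X ∈ σ.stratum l'.reverse → l = l' := fun l hl l' hl' X hX hX' =>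
    List.reverse_injective (σ.stratum_unique (σ.phaseIncreasing_reverse hl)
      (σ.phaseIncreasing_reverse hl') hX hX')
  refine ⟨fun l hl => (hprod l hl).1, ?_, fun m => ?_⟩
  · exact DerivedHall.isLocallyFiniteSum_charFun (fun l _ => σ.isoClosed_stratum l.reverse)
      (fun l hl => (hprod l hl).2) (σ.mem_kappa_iff γ) huniq
  · exact DerivedHall.isLocallyFiniteSum_charFun (fun l _ => σ.isoClosed_stratum l.reverse)
      (fun l hl => (hprod l hl.1).2) (σ.mem_kappaAt_iff m γ)
      (fun l hl l' hl' => huniq l hl.1 l' hl'.1)
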